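/- **Conventions.** For a scheme $X$ and $x\in X$ put $\operatorname{ht}(x)=\dim\mathcal O_{X,x}$. For $T\subset X$ let $\operatorname{Max}(T)$ be the set of points of $T$ that are not a specialisation of another point of $T$, and put $$\operatorname{codim}^+_XT=\sup\{\operatorname{ht}(x)\mid x\in\operatorname{Max}(T)\},\qquad \operatorname{codim}^-_XT=\inf\{\operatorname{ht}(x)\mid x\in\operatorname{Max}(T)\},$$ with $\operatorname{codim}^+_X\emptyset=-1$ and $\operatorname{codim}^-_X\emptyset=\infty$. For a morphism $X\to Y$ with $X$ generically reduced, let $d_{X/Y}=\inf\{\dim_{k_{X,\xi}}\Omega_{X/Y,\xi}\mid \xi\in\operatorname{Max}(X)\}$. The branch locus $B_{X/Y}$ is the set of points $x$ at which the Fitting ideal $F_{d_{X/Y}}(\Omega_{X/Y,x})\subset\mathcal O_{X,x}$ is not the unit ideal (where $\Omega_{X/Y,x}$ is not finitely generated, its Fitting ideals are taken to be zero, and an infinite $d_{X/Y}$ is read as $0$). The morphism $X/Y$ is a differential complete intersection (d.c.i.) if the projective dimension satisfies $\operatorname{pd}\Omega_{X/Y,x}\le 1$ for every $x\in X$. The scheme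 $X$ satisfies $(S_3)$ if $\operatorname{depth}\mathcal O_{X,x}\ge\min(3,\operatorname{ht}(x))$ for every $x\in X$. **Theorem 4.6.** Let $X$, $Y$ and $S$ be integral Noetherian schemes, and let $\pi:X\to Y$ and $Y\to S$ be morphisms, where $\pi$ is dominant, locally of finite type and generically separably algebraic, i.e. the extension of function fields $k(X)/k(Y)$ is separably algebraic. Write $B_\pi=B_{X/Y}$ and $D_\pi=\pi(B_\pi)$, and let $\mathcal V_{X/Y/S}$ be the image of the canonical homomorphism $\pi^*(\Omega_{Y/S})\to\Omega_{X/S}$. Assume: 1. $X$ satisfies $(S_3)$, $X/S$ is d.c.i., and $\operatorname{codim}^-_XB_{X/S}\ge 2$; 2. $\Omega_{Y/S,y}$ is a free $\mathcal O_{Y,y}$-module for every $y\in D_\pi$ for which there is a point $x\in X$ with $\pi(x)=y$ and $\operatorname{ht}(x)\le 2$; 3. $\operatorname{pd}\mathcal V_{X/Y/S,x}\le 1$ for every $x\in X$. Then $\operatorname{codim}^+_XB_\pi\le 1$. -/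

import Mathlib

open CategoryTheory AlgebraicGeometry

universe u

noncomputable section

namespace BranchPurity

/-! ### Commutative algebra -/

/-- The depth of a local ring: the supremum of the lengths of regular sequences in its maximal
ideal. -/
def localDepth (R : Type u) [CommRing R] [IsLocalRing R] : ℕ∞ :=
  sSup {n : ℕ∞ | ∃ rs : List R, (∀ r ∈ rs, r ∈ IsLocalRing.maximalIdeal R) ∧
    RingTheory.Sequence.IsRegular R rs ∧ n = (rs.length : ℕ∞)}

/-- The `i`-th Fitting ideal `F_i(M)` of a finitely generated module `M`: the ideal generated by the
`(n - i) × (n - i)` minors of the relation matrices of families of generators `v_0, …, v_{n-1}`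
of `M`. (For `n ≤ i` the truncated size is `0` and the empty minor `1` gives the unit ideal. The
ideal coming from one finite family of generators does not depend on the family; here all the
families are used at once, so that no choice is involved.) -/
def fittingIdeal (R : Type u) [CommRing R] (M : Type u) [AddCommGroup M] [Module R M] (i : ℕ) :
    Ideal R :=
  Ideal.span {a : R | ∃ (n : ℕ) (v : Fin n → M) (ρ : Fin (n - i) → Fin n → R)
    (c : Fin (n - i) → Fin n),
    Submodule.span R (Set.range v) = ⊤ ∧ (∀ j, ∑ k, ρ j k • v k = 0) ∧
      a = (Matrix.of fun j l => ρ j (c l)).det}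

/-! ### Points of schemes -/

/-- The height of a point: the Krull dimension of its local ring. -/
def ht {X : Scheme.{u}} (x : X) : WithBot ℕ∞ := ringKrullDim (X.presheaf.stalk x)

/-- The maximal points of a subset `T`: the points of `T` to which no other point of `T`
specialises. -/
def maxPoints {X : Scheme.{u}} (T : Set X) : Set X :=
  {x | x ∈ T ∧ ∀ x₁ ∈ T, x₁ ⤳ x → x₁ = x}

/-- The upper codimension: the supremum of the heights of the maximal points of `T`. For empty `T`
it is the bottom element `⊥` of `WithBot ℕ∞`, which plays the role of `-1`. -/
def codimPlus {X : Scheme.{u}} (T : Set X) : WithBot ℕ∞ := ⨆ x ∈ maxPoints T, ht x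

/-- The lower codimension: the infimum of the heights of the maximal points of `T`. For empty `T`
it is `⊤ = ∞`. -/
def codimMinus {X : Scheme.{u}} (T : Set X) : WithBot ℕ∞ := ⨅ x ∈ maxPoints T, ht x

/-- Serre's condition `(S_k)`: `depth 𝒪_{X,x} ≥ min (k, dim 𝒪_{X,x})` for every point `x`. -/
def SerreS (k : ℕ) (X : Scheme.{u}) : Prop :=
  ∀ x : X, min (k : WithBot ℕ∞) (ht x) ≤ (localDepth (X.presheaf.stalk x) : WithBot ℕ∞)

/-! ### Differentials of morphisms of schemes -/

/-- The stalk at `x` of the sheaf of relative differentials of `f : X ⟶ Y`, that is, the module of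
Kähler differentials of the homomorphism of local rings `𝒪_{Y,f x} ⟶ 𝒪_{X,x}`. -/
abbrev stalkOmega {X Y : Scheme.{u}} (f : X ⟶ Y) (x : X) : ModuleCat.{u} (X.presheaf.stalk x) :=
  CommRingCat.KaehlerDifferential (f.stalkMap x)

/-- The stalk at `x` of `𝒱_{X/Y/S}`, for `X ⟶ Y ⟶ S` given by `f` and `g`: the image of the
canonical homomorphism `f^*(Ω_{Y/S})_x = 𝒪_{X,x} ⊗ Ω_{Y/S,f x} ⟶ Ω_{X/S,x}`. -/
def stalkV {X Y S : Scheme.{u}} (f : X ⟶ Y) (g : Y ⟶ S) (x : X) :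
    Submodule (X.presheaf.stalk x) (stalkOmega (f ≫ g) x) :=
  letI : Algebra (S.presheaf.stalk (g (f x))) (Y.presheaf.stalk (f x)) :=
    (g.stalkMap (f x)).hom.toAlgebra
  letI : Algebra (Y.presheaf.stalk (f x)) (X.presheaf.stalk x) := (f.stalkMap x).hom.toAlgebra
  letI : Algebra (S.presheaf.stalk (g (f x))) (X.presheaf.stalk x) :=
    ((f ≫ g).stalkMap x).hom.toAlgebra
  haveI : IsScalarTower (S.presheaf.stalk (g (f x))) (Y.presheaf.stalk (f x))
      (X.presheaf.stalk x) :=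
    IsScalarTower.of_algebraMap_eq' (congrArg CommRingCat.Hom.hom (Scheme.Hom.stalkMap_comp f g x))
  LinearMap.range (KaehlerDifferential.mapBaseChange (S.presheaf.stalk (g (f x)))
    (Y.presheaf.stalk (f x)) (X.presheaf.stalk x))

/-- The relative dimension `d_{X/Y}`: the infimum over the maximal points `ξ` of `X` of the
dimension of `Ω_{X/Y,ξ}` (over `𝒪_{X,ξ}`, which is the residue field of `ξ` when `X` is
generically reduced). -/
def relDim {X Y : Scheme.{u}} (f : X ⟶ Y) : ℕ :=
  ⨅ ξ : maxPoints (Set.univ : Set X),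
    Module.finrank (X.presheaf.stalk (ξ : X)) (stalkOmega f (ξ : X))

/-- The branch locus `B_{X/Y}`: the underlying set of the closed subscheme defined by the Fitting
ideal `F_d(Ω_{X/Y})`, where `d = d_{X/Y}`. -/
def branchLocus {X Y : Scheme.{u}} (f : X ⟶ Y) : Set X :=
  {x | fittingIdeal (X.presheaf.stalk x) (stalkOmega f x) (relDim f) ≠ ⊤}

/-- The discriminant set: the image of the branch locus. -/
def discriminant {X Y : Scheme.{u}} (f : X ⟶ Y) : Set Y := f '' branchLocus f

/-- A differential complete intersection: every stalk of the sheaf of relative differentials has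
projective dimension at most one. -/
def IsDCI {X Y : Scheme.{u}} (f : X ⟶ Y) : Prop :=
  ∀ x : X, HasProjectiveDimensionLE (stalkOmega f x) 1

/-- For integral `X` and dominant `f : X ⟶ Y` with `Y` integral, the homomorphism of local rings
of `f` at the generic point `ξ` of `X` is the extension of function fields of `X/Y`; it is required
to be separably algebraic. -/
def GenericallySeparablyAlgebraic {X Y : Scheme.{u}} [IsIntegral X] (f : X ⟶ Y) : Prop :=
  letI : Algebra (Y.presheaf.stalk (f (genericPoint X))) X.functionField :=
    (f.stalkMap (genericPoint X)).hom.toAlgebra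
  Algebra.IsSeparable (Y.presheaf.stalk (f (genericPoint X))) X.functionField

/-- The class of morphisms `f : X/S ⟶ Y/S` of type `(F)`, the structure morphisms being `f ≫ g`
and `g`. -/
structure IsTypeF {X Y S : Scheme.{u}} (f : X ⟶ Y) (g : Y ⟶ S) : Prop where
  integralX : IsIntegral X
  integralY : IsIntegral Y
  integralS : IsIntegral S
  noetherianX : IsNoetherian X
  noetherianY : IsNoetherian Y
  noetherianS : IsNoetherian S
  dominant : IsDominant f
  locallyOfFiniteType : LocallyOfFiniteType f
  separablyAlgebraic : GenericallySeparablyAlgebraic f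

end BranchPurity

end

/-! Separability at the generic point makes `relDim f = 0`, so the branch locus of `f` is the set of
points where `Ω_{X/Y}` is nonzero. At a maximal point `x` of it, the maximal ideal is associated to
`Ω_{X/Y,x}`, so some `ω ≠ 0` is killed by it (`exists_ne_zero_smul_eq_zero_of_mem_maxPoints`).

Depth excludes such an `ω` when `ht x ≥ 2`. In `0 → 𝒱 → Ω_{X/S} → Ω_{X/Y} → 0`, with `K` the
quotient of the local ring by a regular sequence, `Hom(K, Ω_{X/Y})` lies between `Hom(K, Ω_{X/S})`
and `Ext¹(K, 𝒱)`. Both vanish if the sequence is longer than `pd Ω_{X/S}` and `pd 𝒱 + 1`. In height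
at least 3, `(S₃)` gives length 3 and both dimensions are at most 1. In height 2 the length is only
2, but freeness of `Ω_{Y/S}` makes `𝒱` projective (`projective_stalkV_of_free`). -/

open CategoryTheory.Abelian RingTheory.Sequence

/-! ### Vanishing of Ext from regular sequences -/

section ExtVanishing

variable {R : Type u} [CommRing R]

/-- If a sequence is weakly regular on `M` and kills `K`, then `Ext^i(K, M) = 0` below its
length. -/
lemma ext_eq_zero_of_isWeaklyRegular (K : ModuleCat.{u} R) (rs : List R)
    (hK : ∀ r ∈ rs, ∀ k : K, r • k = 0) (M : ModuleCat.{u} R) (hM : IsWeaklyRegular M rs)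
    (i : ℕ) (hi : i < rs.length) (e : Ext K M i) : e = 0 := by
  induction rs generalizing M i with
  | nil => simp at hi
  | cons r rs ih =>
    rw [isWeaklyRegular_cons_iff] at hM
    have hS := hM.1.smulShortComplex_shortExact
    have hr : r • 𝟙 K = 0 := by
      ext k
      exact hK r (by simp) k
    -- Multiplication by `r` on `Ext` can be computed on either argument, and on `K` it is zero.
    have key : ∀ {j : ℕ} (x : Ext K M j),
        x.comp (Ext.mk₀ (ModuleCat.smulShortComplex M r).f) (add_zero j) = 0 := by
      intro j x
      have h1 : x.comp (Ext.mk₀ (ModuleCat.smulShortComplex M r).f) (add_zero j) = r • x :=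
        (Ext.smul_eq_comp_mk₀ x r).symm
      rw [h1]
      have h2 : r • x = (Ext.mk₀ (r • 𝟙 K)).comp x (zero_add j) := by
        rw [Ext.mk₀_smul, Ext.smul_comp, Ext.mk₀_id_comp]
      rw [h2, hr, Ext.mk₀_zero, Ext.zero_comp]
      rfl
    cases i with
    | zero =>
      have := hS.mono_f
      apply Ext.postcomp_mk₀_injective_of_mono K (ModuleCat.smulShortComplex M r).f
      exact (key e).trans (map_zero _).symm
    | succ i =>
      obtain ⟨x, hx⟩ := Ext.covariant_sequence_exact₁ K hS e (key e) rfl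
      have : x = 0 := ih (fun s hs => hK s (by simp [hs])) (ModuleCat.of R (QuotSMulTop r M)) hM.2 i
        (by simpa using hi) x
      rw [← hx, this, Ext.zero_comp]
      rfl

lemma RingTheory.Sequence.IsWeaklyRegular.of_moduleFlat {rs : List R} (h : IsWeaklyRegular R rs)
    (M : Type u) [AddCommGroup M] [Module R M] [Module.Flat R M] : IsWeaklyRegular M rs :=
  ((TensorProduct.rid R M).isWeaklyRegular_congr rs).mp h.isWeaklyRegular_lTensor

/-- Dimension shifting along a free cover: each step costs one unit of projective dimension and
raises the Ext degree of the kernel by one, so `i + n` is preserved. -/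
lemma ext_eq_zero_of_hasProjectiveDimensionLE (K : ModuleCat.{u} R) (rs : List R)
    (hR : IsWeaklyRegular R rs) (hK : ∀ r ∈ rs, ∀ k : K, r • k = 0) (n : ℕ) (M : ModuleCat.{u} R)
    [HasProjectiveDimensionLE M n] (i : ℕ) (hi : i + n < rs.length) (e : Ext K M i) : e = 0 := by
  induction n generalizing M i with
  | zero =>
    have : Projective M := (projective_iff_hasProjectiveDimensionLE_zero M).mpr ‹_›
    have : Module.Projective R M := (IsProjective.iff_projective (R := R) M).mpr ‹_›
    exact ext_eq_zero_of_isWeaklyRegular K rs hK M (hR.of_moduleFlat M) i hi e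
  | succ n ih =>
    let f : (M →₀ R) →ₗ[R] M := Finsupp.linearCombination R id
    have hf : Function.Surjective f := Finsupp.linearCombination_id_surjective R M
    have hS := LinearMap.shortExact_shortComplexKer hf
    have : Projective f.shortComplexKer.X₂ :=
      (IsProjective.iff_projective (R := R) (M →₀ R)).mp inferInstance
    have : Module.Projective R f.shortComplexKer.X₂ :=
      inferInstanceAs (Module.Projective R (M →₀ R))
    have h1 : HasProjectiveDimensionLE f.shortComplexKer.X₁ n :=
      (hS.hasProjectiveDimensionLT_X₃_iff n inferInstance).mp ‹_›
    obtain ⟨x, hx⟩ := Ext.covariant_sequence_exact₃ K hS e (n₁ := i + 1) rfl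
      (ih f.shortComplexKer.X₁ (i + 1) (by omega) _)
    have : x = 0 := ext_eq_zero_of_isWeaklyRegular K rs hK f.shortComplexKer.X₂
      (hR.of_moduleFlat _) i (by omega) x
    rw [← hx, this, Ext.zero_comp]

/-- In a short exact sequence `0 → A → B → C → 0` whose first two terms have small projective
dimension compared to the length of a weakly `R`-regular sequence, no nonzero element of `C` is
killed by the sequence. -/
lemma eq_zero_of_smul_eq_zero_of_hasProjectiveDimensionLE (rs : List R)
    (hR : IsWeaklyRegular R rs) {A B C : Type u} [AddCommGroup A] [AddCommGroup B] [AddCommGroup C]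
    [Module R A] [Module R B] [Module R C] (f : A →ₗ[R] B) (g : B →ₗ[R] C)
    (hf : Function.Injective f) (hfg : Function.Exact f g) (hg : Function.Surjective g) (a b : ℕ)
    (hA : HasProjectiveDimensionLE (ModuleCat.of R A) a)
    (hB : HasProjectiveDimensionLE (ModuleCat.of R B) b)
    (ha : a + 1 < rs.length) (hb : b < rs.length) (c : C) (hc : ∀ r ∈ rs, r • c = 0) : c = 0 := by
  let S : ShortComplex (ModuleCat.{u} R) :=
    ModuleCat.shortComplexOfCompEqZero f g hfg.linearMap_comp_eq_zero
  have hS : S.ShortExact :=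
    { exact := ModuleCat.shortComplex_exact _ hfg
      mono_f := (ModuleCat.mono_iff_injective _).mpr hf
      epi_g := (ModuleCat.epi_iff_surjective _).mpr hg }
  let I := Ideal.ofList rs
  have hI : I ≤ LinearMap.ker (LinearMap.toSpanSingleton R C c) :=
    Ideal.span_le.mpr fun r hr => by simpa using! hc r hr
  -- An element killed by the sequence is a map from `R ⧸ I`; it lifts to `B` since `Ext¹(R ⧸ I, A)
  -- = 0`, and the lift is zero.
  let φ : (R ⧸ I) →ₗ[R] C := Submodule.liftQ I (LinearMap.toSpanSingleton R C c) hI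
  let K := ModuleCat.of R (R ⧸ I)
  have hK : ∀ r ∈ rs, ∀ k : K, r • k = 0 := by
    intro r hr k
    obtain ⟨k, rfl⟩ := Ideal.Quotient.mk_surjective (I := I) k
    change Ideal.Quotient.mk I (r * k) = 0
    exact Ideal.Quotient.eq_zero_iff_mem.mpr (I.mul_mem_right _ (Ideal.subset_span hr))
  have : HasProjectiveDimensionLE S.X₁ a := hA
  have : HasProjectiveDimensionLE S.X₂ b := hB
  obtain ⟨x, hx⟩ := Ext.covariant_sequence_exact₃ K hS (Ext.mk₀ (ModuleCat.ofHom φ)) (n₁ := 1) rfl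
      (ext_eq_zero_of_hasProjectiveDimensionLE K rs hR hK a S.X₁ 1 (by omega) _)
  have hx0 : x = 0 :=
    ext_eq_zero_of_hasProjectiveDimensionLE K rs hR hK b S.X₂ 0 (by omega) x
  rw [hx0, Ext.zero_comp] at hx
  have hφ : ModuleCat.ofHom φ = 0 := (Ext.mk₀_bijective K S.X₃).1 (by rw [← hx, Ext.mk₀_zero])
  have h1 : φ (Submodule.Quotient.mk 1) = 0 := by
    rw [show φ = 0 from congrArg ModuleCat.Hom.hom hφ]; rfl
  rw [← one_smul R c]
  exact h1

end ExtVanishing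

/-! ### The zeroth Fitting ideal -/

section Fitting

open BranchPurity

variable (R : Type u) [CommRing R] (M : Type u) [AddCommGroup M] [Module R M]

/-- Cramer's rule: multiplying a square relation matrix by its adjugate shows that its determinant
kills every generator. -/
lemma fittingIdeal_zero_le_annihilator : fittingIdeal R M 0 ≤ Module.annihilator R M := by
  refine Ideal.span_le.mpr ?_
  rintro a ⟨n, v, ρ, c, hv, hρ, rfl⟩
  simp only [Nat.sub_zero] at ρ c hρ ⊢
  have key : ∀ j, (Matrix.of ρ).det • v j = 0 := by
    intro j
    have h : ∑ i, (Matrix.of ρ).adjugate j i • ∑ k, ρ i k • v k = 0 := by simp [hρ]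
    simp_rw [Finset.smul_sum, smul_smul] at h
    rw [Finset.sum_comm] at h
    simp_rw [← Finset.sum_smul] at h
    have h' : ∀ k, ∑ i, (Matrix.of ρ).adjugate j i * ρ i k =
        ((Matrix.of ρ).det • (1 : Matrix (Fin n) (Fin n) R)) j k := by
      intro k
      rw [← Matrix.adjugate_mul, Matrix.mul_apply]
      rfl
    simp_rw [h'] at h
    simpa [Matrix.one_apply, ite_smul] using h
  -- The column choice `c` either permutes the columns, which changes only the sign, or repeats one,
  -- which gives zero.
  have hdet : (Matrix.of fun j l => ρ j (c l)).det ∈ Ideal.span {(Matrix.of ρ).det} := by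
    by_cases hc : Function.Injective c
    · let e : Equiv.Perm (Fin n) := Equiv.ofBijective c (Finite.injective_iff_bijective.mp hc)
      have : (Matrix.of fun j l => ρ j (c l)) = (Matrix.of ρ).submatrix id e := rfl
      rw [this, Matrix.det_permute']
      exact Ideal.mul_mem_left _ _ (Ideal.subset_span rfl)
    · simp only [Function.Injective, not_forall] at hc
      obtain ⟨i, j, hij, hne⟩ := hc
      rw [Matrix.det_zero_of_column_eq (M := Matrix.of fun j l => ρ j (c l)) hne
        fun k => congrArg (ρ k) hij]
      exact Submodule.zero_mem _
  obtain ⟨b, hb⟩ := Ideal.mem_span_singleton'.mp hdet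
  rw [SetLike.mem_coe, ← hb, Module.mem_annihilator]
  intro m
  have hm : m ∈ Submodule.span R (Set.range v) := by rw [hv]; trivial
  induction hm using Submodule.span_induction with
  | mem m hm =>
    obtain ⟨j, rfl⟩ := hm
    rw [mul_smul, key, smul_zero]
  | zero => simp
  | add m m' _ _ h h' => rw [smul_add, h, h', add_zero]
  | smul r m _ h => rw [smul_comm, h, smul_zero]

lemma fittingIdeal_zero_eq_top_iff : fittingIdeal R M 0 = ⊤ ↔ Subsingleton M := by
  constructor
  · intro h
    have : Module.annihilator R M = ⊤ := top_le_iff.mp (h ▸ fittingIdeal_zero_le_annihilator R M)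
    exact Module.annihilator_eq_top_iff.mp this
  · intro h
    rw [Ideal.eq_top_iff_one]
    refine Ideal.subset_span ⟨0, Fin.elim0, Fin.elim0, Fin.elim0, Subsingleton.elim _ _,
      fun j => j.elim0, ?_⟩
    have : IsEmpty (Fin (0 - 0)) := Fin.isEmpty
    exact Matrix.det_isEmpty.symm

end Fitting

/-! ### Kähler differentials under étale extension and localization -/

section Kaehler

open KaehlerDifferential TensorProduct

/-- Over `L` the base change map is an isomorphism by étaleness, and flatness embeds `B ⊗ Ω[A⁄R]`
into `L ⊗ Ω[A⁄R]`. -/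
lemma KaehlerDifferential.mapBaseChange_injective_of_formallyEtale (R A B L : Type*) [CommRing R]
    [CommRing A] [CommRing B] [CommRing L] [Algebra R A] [Algebra R B] [Algebra A B]
    [IsScalarTower R A B] [Algebra R L] [Algebra A L] [Algebra B L] [IsScalarTower R A L]
    [IsScalarTower R B L] [IsScalarTower A B L] [Algebra.FormallyEtale A L]
    [Module.Flat A (Ω[A⁄R])] (hBL : Function.Injective (algebraMap B L)) :
    Function.Injective (mapBaseChange R A B) := by
  let j : B →ₗ[A] L := (IsScalarTower.toAlgHom A B L).toLinearMap
  have hj : Function.Injective (j.rTensor (Ω[A⁄R])) :=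
    Module.Flat.rTensor_preserves_injective_linearMap j hBL
  have hcomp : ∀ z, mapBaseChange R A L (j.rTensor _ z) =
      KaehlerDifferential.map R R B L (mapBaseChange R A B z) := by
    intro z
    induction z with
    | zero => simp
    | add z w hz hw => simp only [map_add, hz, hw]
    | tmul b ω =>
      have h1 : (KaehlerDifferential.map R R A L) ω =
          KaehlerDifferential.map R R B L (KaehlerDifferential.map R R A B ω) := by
        have : ω ∈ Submodule.span A (Set.range (D R A)) := by
          rw [span_range_derivation]; trivial
        induction this using Submodule.span_induction with
        | mem ω hω =>
          obtain ⟨a, rfl⟩ := hω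
          simp [← IsScalarTower.algebraMap_apply A B L]
        | zero => simp
        | add ω ω' _ _ h h' => simp [h, h']
        | smul a ω _ h =>
          rw [map_smul, map_smul, h, ← algebraMap_smul B a (KaehlerDifferential.map R R A B ω),
            map_smul, algebraMap_smul]
      simp [j, h1]
  rw [injective_iff_map_eq_zero]
  intro z hz
  have h0 := hcomp z
  rw [hz, map_zero] at h0
  have h1 : j.rTensor _ z = 0 :=
    (tensorKaehlerEquivOfFormallyEtale R A L).injective (by simpa using h0)
  exact hj (by simpa using h1)

/-- If the differentials of `B'/A'` vanish, where `B'` is a localization of `B` and `A → A'` is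
formally unramified, then each differential of `B/A` is killed by a denominator. -/
lemma KaehlerDifferential.exists_smul_eq_zero_of_subsingleton (A B A' B' : Type*) [CommRing A]
    [CommRing B] [CommRing A'] [CommRing B'] [Algebra A B] [Algebra A A'] [Algebra A' B']
    [Algebra B B'] [Algebra A B'] [IsScalarTower A B B'] [IsScalarTower A A' B']
    [Algebra.FormallyUnramified A A'] (M : Submonoid B) [IsLocalization M B']
    [Subsingleton (Ω[B'⁄A'])] (ω : Ω[B⁄A]) : ∃ s ∈ M, s • ω = 0 := by
  have : Algebra.FormallyUnramified A' B' := ⟨‹_›⟩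
  have : Algebra.FormallyUnramified A B' := Algebra.FormallyUnramified.comp A A' B'
  obtain ⟨s, hs⟩ := (IsLocalizedModule.eq_zero_iff M (KaehlerDifferential.map A A B B')
    (m := ω)).mp (Subsingleton.elim _ _)
  exact ⟨s, s.2, hs⟩

end Kaehler

lemma Algebra.FormallyEtale.of_isSeparable_of_isField (K L : Type u) [CommRing K] [CommRing L]
    [Algebra K L] (hK : IsField K) (hL : IsField L) [Algebra.IsSeparable K L] :
    Algebra.FormallyEtale K L := by
  let := hK.toField
  let := hL.toField
  exact Algebra.FormallyEtale.of_isSeparable K L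

/-! ### Stalks and generizations -/

namespace AlgebraicGeometry.Scheme

variable {X Y : Scheme.{u}}

/-- The specialization maps of the stalks of a scheme are localizations. -/
lemma exists_isLocalization_stalkSpecializes {x₁ x : X} (h : x₁ ⤳ x) :
    ∃ M : Submonoid (X.presheaf.stalk x),
      letI := (X.presheaf.stalkSpecializes h).hom.toAlgebra
      IsLocalization M (X.presheaf.stalk x₁) := by
  obtain ⟨_, ⟨U, hU, rfl⟩, hxU, -⟩ :=
    X.isBasis_affineOpens.exists_subset_of_mem_open (Set.mem_univ x) isOpen_univ
  have hx₁U : x₁ ∈ U := h.mem_open U.2 hxU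
  let := (X.presheaf.stalkSpecializes h).hom.toAlgebra
  let : Algebra Γ(X, U) (X.presheaf.stalk x) := (X.presheaf.germ U x hxU).hom.toAlgebra
  let : Algebra Γ(X, U) (X.presheaf.stalk x₁) := (X.presheaf.germ U x₁ hx₁U).hom.toAlgebra
  have : IsScalarTower Γ(X, U) (X.presheaf.stalk x) (X.presheaf.stalk x₁) :=
    .of_algebraMap_eq' (congrArg CommRingCat.Hom.hom
      (X.presheaf.germ_stalkSpecializes hxU h)).symm
  have hl : IsLocalization.AtPrime (X.presheaf.stalk x) (hU.primeIdealOf ⟨x, hxU⟩).asIdeal :=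
    hU.isLocalization_stalk ⟨x, hxU⟩
  have hl₁ : IsLocalization.AtPrime (X.presheaf.stalk x₁) (hU.primeIdealOf ⟨x₁, hx₁U⟩).asIdeal :=
    hU.isLocalization_stalk ⟨x₁, hx₁U⟩
  -- Both stalks localize the sections over one affine open, at nested prime complements.
  refine ⟨_, IsLocalization.isLocalization_of_submonoid_le (X.presheaf.stalk x)
    (X.presheaf.stalk x₁) (hU.primeIdealOf ⟨x, hxU⟩).asIdeal.primeCompl
    (hU.primeIdealOf ⟨x₁, hx₁U⟩).asIdeal.primeCompl fun a ha => ?_⟩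
  have h1 : IsUnit (algebraMap Γ(X, U) (X.presheaf.stalk x₁) a) := by
    rw [IsScalarTower.algebraMap_apply _ (X.presheaf.stalk x)]
    exact (IsLocalization.map_units _ (⟨a, ha⟩ : (hU.primeIdealOf ⟨x, hxU⟩).asIdeal.primeCompl)).map
      _
  exact (IsLocalization.AtPrime.isUnit_to_map_iff (X.presheaf.stalk x₁)
    (hU.primeIdealOf ⟨x₁, hx₁U⟩).asIdeal a).mp h1

lemma formallyEtale_stalkSpecializes {x₁ x : X} (h : x₁ ⤳ x) :
    letI := (X.presheaf.stalkSpecializes h).hom.toAlgebra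
    Algebra.FormallyEtale (X.presheaf.stalk x) (X.presheaf.stalk x₁) := by
  let := (X.presheaf.stalkSpecializes h).hom.toAlgebra
  obtain ⟨M, hM⟩ := exists_isLocalization_stalkSpecializes h
  exact .of_isLocalization M

/-- A germ at `x` lies in the prime ideal corresponding to the generization `x₁` of `x` if and only
if it is not invertible at `x₁`. -/
lemma mem_asIdeal_iff_of_fromSpecStalk_eq {x₁ x : X} (h : x₁ ⤳ x)
    (p : Spec (X.presheaf.stalk x)) (hp : X.fromSpecStalk x p = x₁) (s : X.presheaf.stalk x) :
    s ∈ p.asIdeal ↔ ¬ IsUnit (X.presheaf.stalkSpecializes h s) := by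
  have : Spec.map (X.presheaf.stalkSpecializes h) (IsLocalRing.closedPoint _) = p := by
    apply (IsPreimmersion.isEmbedding (X.fromSpecStalk x)).injective
    exact congr($(SpecMap_stalkSpecializes_fromSpecStalk h) (IsLocalRing.closedPoint _)).trans
      (fromSpecStalk_closedPoint.trans hp.symm)
  rw [← this]
  rfl

lemma isField_stalk_of_eq_genericPoint [IsIntegral X] {x : X} (hx : x = genericPoint X) :
    IsField (X.presheaf.stalk x) :=
  isField_stalk_of_closure_mem_irreducibleComponents X _
    (by simp [hx, irreducibleComponents_eq_singleton, genericPoint_closure])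

lemma apply_genericPoint [IsIntegral X] [IsIntegral Y] (f : X ⟶ Y) [IsDominant f] :
    f (genericPoint X) = genericPoint Y :=
  (((genericPoint_spec X).image f.continuous).eq <| by
    simpa [Set.image_univ, f.denseRange.closure_range] using genericPoint_spec Y)

end AlgebraicGeometry.Scheme

/-! ### The branch locus as the support of the differentials -/

namespace BranchPurity

variable {X Y S : Scheme.{u}}

lemma formallyEtale_stalkMap_genericPoint (f : X ⟶ Y) [IsIntegral X] [IsIntegral Y] [IsDominant f]
    (hf : GenericallySeparablyAlgebraic f) :
    letI := (f.stalkMap (genericPoint X)).hom.toAlgebra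
    Algebra.FormallyEtale (Y.presheaf.stalk (f (genericPoint X))) X.functionField := by
  let := (f.stalkMap (genericPoint X)).hom.toAlgebra
  have : Algebra.IsSeparable (Y.presheaf.stalk (f (genericPoint X))) X.functionField := hf
  exact .of_isSeparable_of_isField _ _
    (Scheme.isField_stalk_of_eq_genericPoint (Scheme.apply_genericPoint f))
    (Scheme.isField_stalk_of_eq_genericPoint rfl)

lemma subsingleton_stalkOmega_genericPoint (f : X ⟶ Y) [IsIntegral X] [IsIntegral Y] [IsDominant f]
    (hf : GenericallySeparablyAlgebraic f) : Subsingleton (stalkOmega f (genericPoint X)) := by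
  let := (f.stalkMap (genericPoint X)).hom.toAlgebra
  have := formallyEtale_stalkMap_genericPoint f hf
  have h : Subsingleton
      (Ω[X.presheaf.stalk (genericPoint X)⁄Y.presheaf.stalk (f (genericPoint X))]) :=
    Algebra.FormallyUnramified.subsingleton_kaehlerDifferential
  exact h

lemma genericPoint_mem_maxPoints_univ [IsIntegral X] :
    genericPoint X ∈ maxPoints (Set.univ : Set X) :=
  ⟨Set.mem_univ _, fun _ _ hx =>
    (hx.antisymm ((genericPoint_spec X).specializes (Set.mem_univ _))).eq⟩

lemma relDim_eq_zero (f : X ⟶ Y) [IsIntegral X] [IsIntegral Y] [IsDominant f]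
    (hf : GenericallySeparablyAlgebraic f) : relDim f = 0 := by
  have := subsingleton_stalkOmega_genericPoint f hf
  have h0 : Module.finrank (X.presheaf.stalk (genericPoint X)) (stalkOmega f (genericPoint X)) = 0 :=
    Module.finrank_zero_of_subsingleton
  refine Nat.le_zero.mp (le_of_le_of_eq ?_ h0)
  exact ciInf_le (f := fun ξ : maxPoints (Set.univ : Set X) =>
    Module.finrank (X.presheaf.stalk (ξ : X)) (stalkOmega f (ξ : X))) (OrderBot.bddBelow _)
    ⟨genericPoint X, genericPoint_mem_maxPoints_univ⟩

lemma mem_branchLocus_iff_of_relDim_eq_zero (f : X ⟶ Y) (hf : relDim f = 0) (x : X) :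
    x ∈ branchLocus f ↔ Nontrivial (stalkOmega f x) := by
  rw [branchLocus, Set.mem_ofPred_eq, hf, Ne, fittingIdeal_zero_eq_top_iff,
    not_subsingleton_iff_nontrivial]

/-- Vanishing at a generization descends to `x` up to a denominator, since the stalks at `x₁` and `f
x₁` are localizations of those at `x` and `f x`. -/
lemma exists_notMem_smul_eq_zero (f : X ⟶ Y) {x₁ x : X} (h : x₁ ⤳ x)
    (p : Spec (X.presheaf.stalk x)) (hp : X.fromSpecStalk x p = x₁)
    (hΩ : Subsingleton (stalkOmega f x₁)) (ω : stalkOmega f x) :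
    ∃ s ∉ p.asIdeal, s • ω = 0 := by
  let := (f.stalkMap x).hom.toAlgebra
  let := (f.stalkMap x₁).hom.toAlgebra
  let := (X.presheaf.stalkSpecializes h).hom.toAlgebra
  let : Algebra (Y.presheaf.stalk (f x)) (Y.presheaf.stalk (f x₁)) :=
    (Y.presheaf.stalkSpecializes (f.base.hom.map_specializes h)).hom.toAlgebra
  let : Algebra (Y.presheaf.stalk (f x)) (X.presheaf.stalk x₁) :=
    (f.stalkMap x ≫ X.presheaf.stalkSpecializes h).hom.toAlgebra
  have : IsScalarTower (Y.presheaf.stalk (f x)) (X.presheaf.stalk x) (X.presheaf.stalk x₁) :=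
    .of_algebraMap_eq' rfl
  have : IsScalarTower (Y.presheaf.stalk (f x)) (Y.presheaf.stalk (f x₁)) (X.presheaf.stalk x₁) :=
    .of_algebraMap_eq' (congrArg CommRingCat.Hom.hom (f.stalkSpecializes_stalkMap x₁ x h)).symm
  obtain ⟨M, hM⟩ := Scheme.exists_isLocalization_stalkSpecializes h
  have := Scheme.formallyEtale_stalkSpecializes (f.base.hom.map_specializes h)
  have : Subsingleton (Ω[X.presheaf.stalk x₁⁄Y.presheaf.stalk (f x₁)]) := hΩ
  obtain ⟨s, hsM, hs⟩ := KaehlerDifferential.exists_smul_eq_zero_of_subsingleton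
    (Y.presheaf.stalk (f x)) (X.presheaf.stalk x) (Y.presheaf.stalk (f x₁))
    (X.presheaf.stalk x₁) M ω
  refine ⟨s, fun hsp => ?_, hs⟩
  exact (Scheme.mem_asIdeal_iff_of_fromSpecStalk_eq h p hp s).mp hsp
    (IsLocalization.map_units (X.presheaf.stalk x₁) ⟨s, hsM⟩)

/-- At a maximal point of the support of the differentials, the maximal ideal is an associated
prime of the module of differentials. -/
lemma exists_ne_zero_smul_eq_zero_of_mem_maxPoints (f : X ⟶ Y) (hf : relDim f = 0) {x : X}
    [IsNoetherianRing (X.presheaf.stalk x)] (hx : x ∈ maxPoints (branchLocus f)) :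
    ∃ ω : stalkOmega f x, ω ≠ 0 ∧
      ∀ r ∈ IsLocalRing.maximalIdeal (X.presheaf.stalk x), r • ω = 0 := by
  have hnt := (mem_branchLocus_iff_of_relDim_eq_zero f hf x).mp hx.1
  obtain ⟨p, hp⟩ := associatedPrimes.nonempty (X.presheaf.stalk x) (stalkOmega f x)
  obtain ⟨hpp, ω, hω⟩ := isAssociatedPrime_iff.mp hp
  have hmem : ∀ r, r ∈ p ↔ r • ω = 0 := fun r => by
    rw [hω, Submodule.mem_colon_singleton, Submodule.mem_bot]
  let P : Spec (X.presheaf.stalk x) := ⟨p, hpp⟩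
  have h : X.fromSpecStalk x P ⤳ x := by
    have : X.fromSpecStalk x P ∈ Set.range (X.fromSpecStalk x) := ⟨P, rfl⟩
    rwa [Scheme.range_fromSpecStalk] at this
  -- Otherwise `ω` would be killed by some `s ∉ p`, although `p` is its annihilator. Maximality of
  -- `x` then forces `P` to be the closed point.
  have hB : X.fromSpecStalk x P ∈ branchLocus f := by
    rw [mem_branchLocus_iff_of_relDim_eq_zero f hf, ← not_subsingleton_iff_nontrivial]
    intro hs
    obtain ⟨s, hsP, hs⟩ := exists_notMem_smul_eq_zero f h P rfl hs ω
    exact hsP ((hmem s).mpr hs)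
  have hPc : P = IsLocalRing.closedPoint _ :=
    (IsPreimmersion.isEmbedding (X.fromSpecStalk x)).injective
      ((hx.2 _ hB h).trans Scheme.fromSpecStalk_closedPoint.symm)
  have hpm : p = IsLocalRing.maximalIdeal (X.presheaf.stalk x) :=
    congrArg PrimeSpectrum.asIdeal hPc
  refine ⟨ω, ?_, fun r hr => ?_⟩
  · rintro rfl
    exact hpp.ne_top ((Ideal.eq_top_iff_one p).mpr ((hmem 1).mpr (smul_zero _)))
  · exact (hmem r).mp (hpm ▸ hr)

end BranchPurity

/-! ### The sheaf `𝒱` and the depth argument -/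

namespace BranchPurity

variable {X Y S : Scheme.{u}}

/-- If `Ω_{Y/S}` is free at `f x`, then `𝒱_{X/Y/S}` is projective at `x`. -/
lemma projective_stalkV_of_free (f : X ⟶ Y) (g : Y ⟶ S) [IsIntegral X] [IsIntegral Y] [IsDominant f]
    (hf : GenericallySeparablyAlgebraic f) (x : X)
    (hfree : Module.Free (Y.presheaf.stalk (f x)) (stalkOmega g (f x))) :
    Module.Projective (X.presheaf.stalk x) (stalkV f g x) := by
  let : Algebra (S.presheaf.stalk (g (f x))) (Y.presheaf.stalk (f x)) :=
    (g.stalkMap (f x)).hom.toAlgebra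
  let : Algebra (Y.presheaf.stalk (f x)) (X.presheaf.stalk x) := (f.stalkMap x).hom.toAlgebra
  let : Algebra (S.presheaf.stalk (g (f x))) (X.presheaf.stalk x) :=
    ((f ≫ g).stalkMap x).hom.toAlgebra
  have : IsScalarTower (S.presheaf.stalk (g (f x))) (Y.presheaf.stalk (f x))
      (X.presheaf.stalk x) :=
    .of_algebraMap_eq' (congrArg CommRingCat.Hom.hom (Scheme.Hom.stalkMap_comp f g x))
  have hξ : genericPoint X ⤳ x := (genericPoint_spec X).specializes trivial
  let : Algebra (Y.presheaf.stalk (f (genericPoint X))) X.functionField :=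
    (f.stalkMap (genericPoint X)).hom.toAlgebra
  let : Algebra (Y.presheaf.stalk (f x)) (Y.presheaf.stalk (f (genericPoint X))) :=
    (Y.presheaf.stalkSpecializes (f.base.hom.map_specializes hξ)).hom.toAlgebra
  let : Algebra (Y.presheaf.stalk (f x)) X.functionField :=
    (f.stalkMap x ≫ X.presheaf.stalkSpecializes hξ).hom.toAlgebra
  let : Algebra (S.presheaf.stalk (g (f x))) X.functionField :=
    ((f ≫ g).stalkMap x ≫ X.presheaf.stalkSpecializes hξ).hom.toAlgebra
  have : IsScalarTower (Y.presheaf.stalk (f x)) (X.presheaf.stalk x) X.functionField :=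
    .of_algebraMap_eq' rfl
  have : IsScalarTower (S.presheaf.stalk (g (f x))) (X.presheaf.stalk x) X.functionField :=
    .of_algebraMap_eq' rfl
  have : IsScalarTower (S.presheaf.stalk (g (f x))) (Y.presheaf.stalk (f x)) X.functionField :=
    .of_algebraMap_eq' (congrArg CommRingCat.Hom.hom
      (congrArg (· ≫ X.presheaf.stalkSpecializes hξ) (Scheme.Hom.stalkMap_comp f g x)))
  have : IsScalarTower (Y.presheaf.stalk (f x)) (Y.presheaf.stalk (f (genericPoint X)))
      X.functionField :=
    .of_algebraMap_eq' (congrArg CommRingCat.Hom.hom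
      (f.stalkSpecializes_stalkMap (genericPoint X) x hξ)).symm
  have := Scheme.formallyEtale_stalkSpecializes (f.base.hom.map_specializes hξ)
  have := formallyEtale_stalkMap_genericPoint f hf
  -- A localization followed by a separable algebraic field extension.
  have : Algebra.FormallyEtale (Y.presheaf.stalk (f x)) X.functionField :=
    .comp _ (Y.presheaf.stalk (f (genericPoint X))) _
  have : Module.Free (Y.presheaf.stalk (f x))
      (Ω[Y.presheaf.stalk (f x)⁄S.presheaf.stalk (g (f x))]) := hfree
  have hinj := KaehlerDifferential.mapBaseChange_injective_of_formallyEtale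
    (S.presheaf.stalk (g (f x))) (Y.presheaf.stalk (f x)) (X.presheaf.stalk x) X.functionField
    (IsFractionRing.injective (X.presheaf.stalk x) X.functionField)
  exact .of_equiv (LinearEquiv.ofInjective _ hinj)

/-- The module of differentials `Ω_{X/Y,x}` has no nonzero element killed by a regular sequence
that is long compared to the projective dimensions of `𝒱_{X/Y/S,x}` and `Ω_{X/S,x}`. -/
lemma eq_zero_of_smul_eq_zero_of_stalkV (f : X ⟶ Y) (g : Y ⟶ S) (x : X)
    (rs : List (X.presheaf.stalk x)) (hrs : RingTheory.Sequence.IsWeaklyRegular (X.presheaf.stalk x) rs) (a b : ℕ)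
    (hV : HasProjectiveDimensionLE (ModuleCat.of (X.presheaf.stalk x) (stalkV f g x)) a)
    (hΩ : HasProjectiveDimensionLE (stalkOmega (f ≫ g) x) b)
    (ha : a + 1 < rs.length) (hb : b < rs.length) (ω : stalkOmega f x)
    (hω : ∀ r ∈ rs, r • ω = 0) : ω = 0 := by
  let : Algebra (S.presheaf.stalk (g (f x))) (Y.presheaf.stalk (f x)) :=
    (g.stalkMap (f x)).hom.toAlgebra
  let : Algebra (Y.presheaf.stalk (f x)) (X.presheaf.stalk x) := (f.stalkMap x).hom.toAlgebra
  let : Algebra (S.presheaf.stalk (g (f x))) (X.presheaf.stalk x) :=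
    ((f ≫ g).stalkMap x).hom.toAlgebra
  have : IsScalarTower (S.presheaf.stalk (g (f x))) (Y.presheaf.stalk (f x))
      (X.presheaf.stalk x) :=
    .of_algebraMap_eq' (congrArg CommRingCat.Hom.hom (Scheme.Hom.stalkMap_comp f g x))
  refine eq_zero_of_smul_eq_zero_of_hasProjectiveDimensionLE rs hrs (stalkV f g x).subtype
    (B := stalkOmega (f ≫ g) x) (C := stalkOmega f x)
    (KaehlerDifferential.map (S.presheaf.stalk (g (f x))) (Y.presheaf.stalk (f x))
      (X.presheaf.stalk x) (X.presheaf.stalk x)) Subtype.val_injective ?_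
    (KaehlerDifferential.map_surjective _ _ _) a b hV hΩ ha hb ω hω
  intro z
  refine ((KaehlerDifferential.exact_mapBaseChange_map (S.presheaf.stalk (g (f x)))
    (Y.presheaf.stalk (f x)) (X.presheaf.stalk x)) z).trans ?_
  constructor
  · intro hz
    exact ⟨⟨z, hz⟩, rfl⟩
  · rintro ⟨w, rfl⟩
    exact w.2

lemma exists_isWeaklyRegular_of_le_localDepth (R : Type u) [CommRing R] [IsLocalRing R] (n : ℕ)
    (h : (n : ℕ∞) ≤ localDepth R) (hn : n ≠ 0) :
    ∃ rs : List R, (∀ r ∈ rs, r ∈ IsLocalRing.maximalIdeal R) ∧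
      RingTheory.Sequence.IsWeaklyRegular R rs ∧ n ≤ rs.length := by
  obtain ⟨m, rfl⟩ := Nat.exists_eq_succ_of_ne_zero hn
  -- Passing to `m = n - 1` gives a strict inequality, so an actual sequence exceeds `m` without the
  -- supremum having to be attained.
  have hlt : (m : ℕ∞) < localDepth R := lt_of_lt_of_le (by exact_mod_cast Nat.lt_succ_self m) h
  obtain ⟨_, ⟨rs, hmem, hreg, rfl⟩, hrs⟩ := lt_sSup_iff.mp hlt
  exact ⟨rs, hmem, hreg.toIsWeaklyRegular, by exact_mod_cast hrs⟩

end BranchPurity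

theorem theorem4p6 {X Y S : Scheme.{u}} (f : X ⟶ Y) (g : Y ⟶ S)
    (hF : BranchPurity.IsTypeF f g)
    (hS3 : BranchPurity.SerreS 3 X)
    (hdci : BranchPurity.IsDCI (f ≫ g))
    (hcodim : 2 ≤ BranchPurity.codimMinus (BranchPurity.branchLocus (f ≫ g)))
    (hfree : ∀ y ∈ BranchPurity.discriminant f, ∀ x : X, f x = y → BranchPurity.ht x ≤ 2 →
      Module.Free (Y.presheaf.stalk y) (BranchPurity.stalkOmega g y))
    (hV : ∀ x : X, HasProjectiveDimensionLE
      (ModuleCat.of (X.presheaf.stalk x) (BranchPurity.stalkV f g x)) 1) :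
    BranchPurity.codimPlus (BranchPurity.branchLocus f) ≤ 1 := by
  have := hF.integralX
  have := hF.integralY
  have := hF.noetherianX
  have := hF.dominant
  refine iSup₂_le fun x hx => ?_
  by_contra! hht
  obtain ⟨ω, hω0, hω⟩ := BranchPurity.exists_ne_zero_smul_eq_zero_of_mem_maxPoints f
    (BranchPurity.relDim_eq_zero f hF.separablyAlgebraic) hx
  have hdepth := hS3 x
  have h2 : 2 ≤ BranchPurity.ht x := by
    simpa [one_add_one_eq_two] using
      ENat.WithBot.add_one_le_iff (n := 1).mpr (by exact_mod_cast hht)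
  by_cases h : BranchPurity.ht x ≤ 2
  · have hd : ((2 : ℕ) : ℕ∞) ≤ BranchPurity.localDepth (X.presheaf.stalk x) := by
      rw [le_antisymm h h2] at hdepth
      have : ((2 : ℕ) : WithBot ℕ∞) ≤ min ((3 : ℕ) : WithBot ℕ∞) 2 :=
        le_min (by exact_mod_cast Nat.le_succ 2) le_rfl
      exact WithBot.coe_le_coe.mp (this.trans hdepth)
    obtain ⟨rs, hmem, hreg, hlen⟩ :=
      BranchPurity.exists_isWeaklyRegular_of_le_localDepth _ 2 hd (by norm_num)
    have := BranchPurity.projective_stalkV_of_free f g hF.separablyAlgebraic x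
      (hfree (f x) ⟨x, hx.1, rfl⟩ x rfl h)
    have hproj : Projective (ModuleCat.of (X.presheaf.stalk x) (BranchPurity.stalkV f g x)) :=
      (IsProjective.iff_projective _).mp this
    -- Length 2 suffices only because `𝒱` has projective dimension 0 here.
    exact hω0 (BranchPurity.eq_zero_of_smul_eq_zero_of_stalkV f g x rs hreg 0 1
      ((projective_iff_hasProjectiveDimensionLE_zero _).mp hproj) (hdci x) (by omega) (by omega) ω
      fun r hr => hω r (hmem r hr))
  · have h3 : ((3 : ℕ) : WithBot ℕ∞) ≤ BranchPurity.ht x := by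
      exact_mod_cast ENat.WithBot.add_one_le_iff (n := 2).mpr (by exact_mod_cast not_le.mp h)
    rw [min_eq_left h3] at hdepth
    obtain ⟨rs, hmem, hreg, hlen⟩ := BranchPurity.exists_isWeaklyRegular_of_le_localDepth
      (X.presheaf.stalk x) 3 (WithBot.coe_le_coe.mp hdepth) (by norm_num)
    exact hω0 (BranchPurity.eq_zero_of_smul_eq_zero_of_stalkV f g x rs hreg 1 1
      (hV x) (hdci x) (by omega) (by omega) ω fun r hr => hω r (hmem r hr))
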